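/- Let $\Bbbk$ be a field, let $n\ge 0$, and let $P=[1,n]=\{1,\dots,n\}$ be equipped with a partial order $\le_P$ that is compatible with the usual order, i.e. $i<_P j$ implies $i<j$ in $\mathbb{Z}$. Let $L(P)$ be the distributive lattice of poset ideals (down-closed subsets) of $P$, let $S=\Bbbk[x_\alpha : \alpha\in L(P)]$, let $I$ be the ideal of $S$ generated by the binomials $x_\alpha x_\beta-x_{\alpha\cap\beta}x_{\alpha\cup\beta}$ for incomparable $\alpha,\beta\in L(P)$, and let $\Bbbk[P]=S/I$ be the Hibi ring of $P$. Let $C=\{c_1<_P\cdots<_P c_\ell\}$ ($\ell\ge 0$) be a chain in $P$, and let $\Bbbk[P]$ be $\mathbb{Z}^{\ell+1}$-graded by $\deg(x_\alpha)=\mathbf{e}_{|\alpha\cap C|}$, where $\mathbf{e}_0,\dots,\mathbf{e}_\ell$ are the unit vectors of $\mathbb{Z}^{\ell+1}$. Let $\mathrm{HS}(\Bbbk[P];\mathbf{t})=\sum_{\mathbf{a}\in\mathbb{Z}_{\ge 0}^{\ell+1}}\dim_\Bbbk(\Bbbk[P]_{\mathbf{a}})\,\mathbf{t}^{\mathbf{a}}$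 be its multigraded Hilbert series. Let $e(P)$ be the set of permutations $\pi=(p_1,\dots,p_n)$ of $[1,n]$ such that $i<j$ whenever $p_i<_P p_j$. For $\pi\in e(P)$, put $p_{n+1}:=n+1$ and $d_i(\pi):=|\{j\in[i,n] : p_j>p_{j+1}\}|$ for $i\in[1,n]$, with $d_0(\pi):=d_1(\pi)$ (and $d_0(\pi):=0$ if $n=0$) and $d_{n+1}(\pi):=0$. For $j\in[1,\ell]$ let $\mathrm{ind}(\pi,c_j)$ be the position of $c_j$ in $\pi$, i.e. $c_j=p_{\mathrm{ind}(\pi,c_j)}$, and put $\mathrm{ind}(\pi,c_0):=0$ and $\mathrm{ind}(\pi,c_{\ell+1}):=n+1$. Then $$\mathrm{HS}(\Bbbk[P];\mathbf{t})=\sum_{\pi\in e(P)}\ \prod_{i\in[0,\ell]}\frac{t_i^{\,d_{\mathrm{ind}(\pi,c_i)}(\pi)-d_{\mathrm{ind}(\pi,c_{i+1})}(\pi)}}{(1-t_i)^{\mathrm{ind}(\pi,c_{i+1})-\mathrm{ind}(\pi,c_i)}}.$$ -/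

import Mathlib

noncomputable section

namespace MultigradedHibi

open MvPolynomial

/-- The ideal `I_L` of `k[x_α : α ∈ L]` generated by the binomials
`x_α x_β - x_{α ∧ β} x_{α ∨ β}`, for `α, β` incomparable in the lattice `L`. -/
def latticeIdeal (k : Type*) [Field k] (L : Type*) [Lattice L] : Ideal (MvPolynomial L k) :=
  Ideal.span {f | ∃ α β : L, ¬ α ≤ β ∧ ¬ β ≤ α ∧
    f = X α * X β - X (α ⊓ β) * X (α ⊔ β)}

/-- The Hibi ideal `I_{L(P)}` of a poset `P`. Here `L(P)`, the lattice of poset ideals of `P`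
under intersection and union, is Mathlib's `LowerSet P`; the Hibi ring `k[P]` is the quotient
of `MvPolynomial (LowerSet P) k` by this ideal. -/
abbrev hibiIdeal (k : Type*) [Field k] (P : Type*) [PartialOrder P] :
    Ideal (MvPolynomial (LowerSet P) k) :=
  latticeIdeal k (LowerSet P)

/-- The component `(S/I)_a` of degree `a` of `S/I`, where `S` is the polynomial ring in which the
variable `x_s` has degree `w s`: the image of `S_a` in `S/I`, i.e. `S_a / (I ∩ S_a)`. -/
def quotientComponent {k σ ι : Type*} [Field k] (w : σ → ι →₀ ℕ) (I : Ideal (MvPolynomial σ k))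
    (a : ι →₀ ℕ) : Submodule k (MvPolynomial σ k ⧸ I) :=
  (weightedHomogeneousSubmodule k w a).map (Ideal.Quotient.mkₐ k I).toLinearMap

/-- The multigraded Hilbert function `HF(S/I; a) = dim_k (S/I)_a`. -/
def hilbertFunction {k σ ι : Type*} [Field k] (w : σ → ι →₀ ℕ) (I : Ideal (MvPolynomial σ k))
    (a : ι →₀ ℕ) : ℕ :=
  Module.finrank k (quotientComponent w I a)

/-- The multigraded Hilbert series `HS(S/I; t) = ∑ₐ dim_k (S/I)_a t^a`, as a formal power series
with rational coefficients. -/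
def hilbertSeries {k σ ι : Type*} [Field k] (w : σ → ι →₀ ℕ) (I : Ideal (MvPolynomial σ k)) :
    MvPowerSeries ι ℚ :=
  fun a => (hilbertFunction w I a : ℚ)

open Classical in
/-- For a chain `C = {c 0 < ⋯ < c (ℓ - 1)}` of `P` and a poset ideal `α`, the degree
`deg_C(x_α) = e_{|α ∩ C|}`, a unit vector of `ℤ^{ℓ+1}` with coordinates numbered from `0` to `ℓ`.
(As `c` is injective, `|α ∩ C|` is the number of indices `i` with `c i ∈ α`.) -/
def chainDegree {P : Type*} [PartialOrder P] {ℓ : ℕ} (c : Fin ℓ → P) (α : LowerSet P) :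
    Fin (ℓ + 1) →₀ ℕ :=
  Finsupp.single
    ⟨(Finset.univ.filter fun i : Fin ℓ => c i ∈ α).card,
      Nat.lt_succ_of_le ((Finset.card_filter_le _ _).trans_eq (Finset.card_fin ℓ))⟩ 1

open Classical in
/-- The Jordan–Hölder set `e(P)` of a poset `P` whose elements are labelled through `ω`:
the permutations `π = (p_1, …, p_n)` such that `i < j` whenever `p_i <_P p_j`.
Labels and positions both run through `Fin n`, i.e. are shifted by one: `p_{i+1} = π i + 1`. -/
def jordanHolderSet {P : Type*} [PartialOrder P] {n : ℕ} (ω : P ≃ Fin n) :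
    Finset (Equiv.Perm (Fin n)) :=
  Finset.univ.filter fun π => ∀ i j : Fin n, ω.symm (π i) < ω.symm (π j) → i < j

/-- `d_i(π) = |{j ∈ [i, n] : p_j > p_{j+1}}|` with `p_{n+1} = n + 1` (so `j = n` never counts).
The element `j` of `Fin n` stands for the position `j + 1`. In particular `d_0 = d_1` and
`d_{n+1} = 0`. -/
def descentsFrom {n : ℕ} (π : Equiv.Perm (Fin n)) (i : ℕ) : ℕ :=
  (Finset.univ.filter fun j : Fin n =>
    i ≤ (j : ℕ) + 1 ∧ ∃ h : (j : ℕ) + 1 < n, π ⟨(j : ℕ) + 1, h⟩ < π j).card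

/-- `ind(π, c_i)` for `0 ≤ i ≤ ℓ + 1`: the position, between `1` and `n`, at which `c_i` occurs in
`π` if `1 ≤ i ≤ ℓ`, and `ind(π, c_0) = 0`, `ind(π, c_{ℓ+1}) = n + 1`.
The chain element `c_{i+1}` is `c i`. -/
def chainIndex {P : Type*} {n ℓ : ℕ} (ω : P ≃ Fin n) (c : Fin ℓ → P)
    (π : Equiv.Perm (Fin n)) : ℕ → ℕ
  | 0 => 0
  | i + 1 => if h : i < ℓ then ((π.symm (ω (c ⟨i, h⟩)) : Fin n) : ℕ) + 1 else n + 1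

end MultigradedHibi

end

noncomputable section

namespace MultigradedHibi

open MvPolynomial

/-! Modulo the Hibi ideal every monomial equals one supported on a chain of poset ideals
(`exists_isChain_monomial_sub_mem`). The toric map `x_α ↦ s ∏_{p ∈ α} y_p` kills the ideal and
separates these standard monomials, so they form a basis of the Hibi ring. Each standard monomial
comes from exactly one linear extension π, as a product of powers `e j` of the variables of the
prefix ideals of π, with `e j ≥ 1` at every descent `j`. Here π lists `P` by decreasing
`y`-exponent, ties broken by increasing label (`exists_prefixExponent_eq`,
`prefixExponent_weight_injective`). For fixed π, the prefix of length `j` contributes the variable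
`t_i`, where `i` counts its chain elements. Summing over `e` gives a product over `j ∈ [0, n]` of
`t_i / (1 - t_i)` at descents and `1 / (1 - t_i)` elsewhere; grouping the `j` by `i` gives the
formula (`prod_chainIndex_eq`). -/

/-! ### Straightening to standard monomials. -/

/-- Trading an incomparable pair for its meet and join strictly lowers the `ρ`-weight, so the
rewriting terminates; `hw` keeps the degree fixed throughout. -/
theorem exists_isChain_monomial_sub_mem {k L M : Type*} [Field k] [Lattice L] [AddCommMonoid M]
    (ρ : L → ℕ) (hρ : ∀ α β, ¬ α ≤ β → ¬ β ≤ α → ρ (α ⊓ β) + ρ (α ⊔ β) < ρ α + ρ β)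
    (w : L → M) (hw : ∀ α β, w (α ⊓ β) + w (α ⊔ β) = w α + w β) (m : L →₀ ℕ) :
    ∃ m' : L →₀ ℕ, IsChain (· ≤ ·) (m'.support : Set L) ∧
      Finsupp.weight w m' = Finsupp.weight w m ∧
      (monomial m 1 - monomial m' 1 : MvPolynomial L k) ∈ latticeIdeal k L := by
  classical
  induction hN : Finsupp.weight ρ m using Nat.strong_induction_on generalizing m with
  | _ N ih =>
    subst hN
    by_cases hm : IsChain (· ≤ ·) (m.support : Set L)
    · exact ⟨m, hm, rfl, by simp⟩
    · obtain ⟨α, hα, β, hβ, hne, hαβ, hβα⟩ : ∃ α ∈ m.support, ∃ β ∈ m.support,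
          α ≠ β ∧ ¬ α ≤ β ∧ ¬ β ≤ α := by
        simpa [IsChain, Set.Pairwise, not_or] using hm
      obtain ⟨m₀, rfl⟩ : ∃ m₀, m = m₀ + (Finsupp.single α 1 + Finsupp.single β 1) := by
        refine ⟨m - (Finsupp.single α 1 + Finsupp.single β 1), (tsub_add_cancel_of_le ?_).symm⟩
        intro γ
        simp only [Finsupp.mem_support_iff] at hα hβ
        simp only [Finsupp.add_apply, Finsupp.single_apply]
        split_ifs <;> grind
      obtain ⟨m', h1, h2, h3⟩ :=
        ih (Finsupp.weight ρ (m₀ + (Finsupp.single (α ⊓ β) 1 + Finsupp.single (α ⊔ β) 1)))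
          (by simpa [Finsupp.weight_single] using hρ α β hαβ hβα) _ rfl
      refine ⟨m', h1, ?_, ?_⟩
      · rw [h2]
        simp [Finsupp.weight_single, hw]
      · have h4 : (monomial m₀ 1 * (X α * X β - X (α ⊓ β) * X (α ⊔ β)) : MvPolynomial L k) ∈
            latticeIdeal k L :=
          Ideal.mul_mem_left _ _ (Ideal.subset_span ⟨α, β, hαβ, hβα, rfl⟩)
        have h5 := add_mem h4 h3
        convert h5 using 1
        simp only [X, mul_sub, monomial_mul, mul_one]
        ring

/-! ### Degrees on the ideal lattice and the toric map. -/

section LowerSet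

variable {P : Type*} [PartialOrder P]

/-- Supplies `ρ` for straightening: `x ↦ x (N - x)` is strictly concave, and the sizes of meet and
join have the same sum as those of `α` and `β` but lie further apart. -/
theorem concave_rank_lt [Finite P] {α β : LowerSet P} (hαβ : ¬ α ≤ β) (hβα : ¬ β ≤ α) :
    ((α ⊓ β : LowerSet P) : Set P).ncard * (Nat.card P - ((α ⊓ β : LowerSet P) : Set P).ncard) +
      ((α ⊔ β : LowerSet P) : Set P).ncard * (Nat.card P - ((α ⊔ β : LowerSet P) : Set P).ncard) <
    (α : Set P).ncard * (Nat.card P - (α : Set P).ncard) +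
      (β : Set P).ncard * (Nat.card P - (β : Set P).ncard) := by
  have h1 := Set.ncard_union_add_ncard_inter (α : Set P) (β : Set P)
  have h2 : ((α : Set P) ∩ β).ncard < (α : Set P).ncard :=
    Set.ncard_lt_ncard (Set.inter_ssubset_left_iff.2 (by simpa using hαβ))
  have h3 : ((α : Set P) ∩ β).ncard < (β : Set P).ncard :=
    Set.ncard_lt_ncard (Set.inter_ssubset_right_iff.2 (by simpa using hβα))
  have h4 : ((α : Set P) ∪ β).ncard ≤ Nat.card P := by
    rw [← Set.ncard_univ]; exact Set.ncard_le_ncard (Set.subset_univ _)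
  rw [LowerSet.coe_inf, LowerSet.coe_sup]
  generalize ((α : Set P) ∪ β).ncard = u at *
  generalize ((α : Set P) ∩ β).ncard = v at *
  generalize (α : Set P).ncard = x at *
  generalize (β : Set P).ncard = y at *
  generalize Nat.card P = N at *
  obtain ⟨x, rfl⟩ := Nat.exists_eq_add_of_lt h2
  obtain ⟨y, rfl⟩ := Nat.exists_eq_add_of_lt h3
  obtain rfl : u = v + x + 1 + y + 1 := by omega
  obtain ⟨N, rfl⟩ := Nat.exists_eq_add_of_le h4
  rw [show v + x + 1 + y + 1 + N - v = x + y + 2 + N by omega,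
    show v + x + 1 + y + 1 + N - (v + x + 1 + y + 1) = N by omega,
    show v + x + 1 + y + 1 + N - (v + x + 1) = y + 1 + N by omega,
    show v + x + 1 + y + 1 + N - (v + y + 1) = x + 1 + N by omega]
  nlinarith [Nat.zero_le (x * y)]

/-- Both ideals meet the chain in initial segments, so one trace contains the other, and meet and
join have the same two traces. -/
theorem chainDegree_inf_add_sup {ℓ : ℕ} {c : Fin ℓ → P} (hc : StrictMono c) (α β : LowerSet P) :
    chainDegree c (α ⊓ β) + chainDegree c (α ⊔ β) = chainDegree c α + chainDegree c β := by
  classical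
  have key : (∀ i, c i ∈ α → c i ∈ β) ∨ (∀ i, c i ∈ β → c i ∈ α) := by
    by_contra! h
    obtain ⟨⟨i, hi, hi'⟩, j, hj, hj'⟩ := h
    rcases le_total i j with hij | hij
    · exact hi' (β.lower (hc.monotone hij) hj)
    · exact hj' (α.lower (hc.monotone hij) hi)
  unfold chainDegree
  rcases key with h | h
  · have h1 : ∀ i, c i ∈ α ⊓ β ↔ c i ∈ α := fun i => by
      rw [LowerSet.mem_inf_iff]; exact ⟨fun h => h.1, fun h' => ⟨h', h i h'⟩⟩
    have h2 : ∀ i, c i ∈ α ⊔ β ↔ c i ∈ β := fun i => by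
      rw [LowerSet.mem_sup_iff]; exact ⟨fun h' => h'.elim (h i) id, Or.inr⟩
    simp only [h1, h2]
  · have h1 : ∀ i, c i ∈ α ⊓ β ↔ c i ∈ β := fun i => by
      rw [LowerSet.mem_inf_iff]; exact ⟨fun h => h.2, fun h' => ⟨h i h', h'⟩⟩
    have h2 : ∀ i, c i ∈ α ⊔ β ↔ c i ∈ α := fun i => by
      rw [LowerSet.mem_sup_iff]; exact ⟨fun h' => h'.elim id (h i), Or.inl⟩
    simp only [h1, h2]
    exact add_comm _ _

open Classical in
/-- The exponent vector of `s * ∏_{p ∈ α} y_p`, the image of `x_α` in the toric ring. -/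
def toricExponent [Finite P] (α : LowerSet P) : Option P →₀ ℕ :=
  Finsupp.equivFunOnFinite.symm fun o => o.elim 1 fun p => if p ∈ α then 1 else 0

theorem toricExponent_inf_add_sup [Finite P] (α β : LowerSet P) :
    toricExponent (α ⊓ β) + toricExponent (α ⊔ β) = toricExponent α + toricExponent β := by
  ext o
  cases o with
  | none => simp [toricExponent]
  | some p => by_cases h1 : p ∈ α <;> by_cases h2 : p ∈ β <;> simp [toricExponent, h1, h2]

/-- The homomorphism from the polynomial ring on `L(P)` with image the toric ring of `P`. -/
def toricHom (k : Type*) [Field k] (P : Type*) [PartialOrder P] [Finite P] :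
    MvPolynomial (LowerSet P) k →ₐ[k] MvPolynomial (Option P) k :=
  aeval fun α => monomial (toricExponent α) 1

theorem toricHom_monomial (k : Type*) [Field k] [Finite P] (m : LowerSet P →₀ ℕ) :
    toricHom k P (monomial m 1) = monomial (Finsupp.weight toricExponent m) 1 := by
  rw [toricHom, aeval_monomial, Finsupp.weight_apply, map_one, one_mul, Finsupp.prod,
    Finsupp.sum, monomial_sum_one]
  simp [monomial_pow]

theorem toricHom_eq_zero (k : Type*) [Field k] [Finite P] {f : MvPolynomial (LowerSet P) k}
    (hf : f ∈ hibiIdeal k P) : toricHom k P f = 0 := by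
  suffices h : hibiIdeal k P ≤ RingHom.ker (toricHom k P) from h hf
  refine Ideal.span_le.2 ?_
  rintro _ ⟨α, β, -, -, rfl⟩
  simp [RingHom.mem_ker, toricHom, monomial_mul, toricExponent_inf_add_sup]

end LowerSet

/-! ### Standard monomials as linear extensions with multiplicities. -/

/-- `π` has a descent between its `m`-th and `(m + 1)`-st entries (positions start at `1`). -/
def IsDescent {n : ℕ} (π : Equiv.Perm (Fin n)) (m : ℕ) : Prop :=
  ∃ j : Fin n, (j : ℕ) + 1 = m ∧ ∃ h : (j : ℕ) + 1 < n, π ⟨(j : ℕ) + 1, h⟩ < π j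

theorem apply_lt_apply_of_forall_not_isDescent {n : ℕ} (π : Equiv.Perm (Fin n)) {i j : Fin n}
    (hij : i < j) (h : ∀ m : ℕ, (i : ℕ) < m → m ≤ j → ¬ IsDescent π m) : π i < π j := by
  obtain ⟨j, hj⟩ := j
  replace hij : (i : ℕ) + 1 ≤ j := hij
  have step : ∀ a (ha : a + 1 < n), (i : ℕ) < a + 1 → a + 1 ≤ j →
      π ⟨a, Nat.lt_of_succ_lt ha⟩ < π ⟨a + 1, ha⟩ := fun a ha h1 h2 => by
    refine lt_of_le_of_ne (not_lt.1 fun hlt => h (a + 1) h1 h2 ⟨⟨a, by omega⟩, rfl, ha, hlt⟩) ?_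
    simp
  induction j, hij using Nat.le_induction with
  | base => exact step i hj (by omega) le_rfl
  | succ b hb ih =>
    exact (ih (by omega) (fun m h1 h2 => h m h1 (by simp only at h2 ⊢; omega))
      fun a ha h1 h2 => step a ha h1 (by omega)).trans (step b hj (by omega) le_rfl)

section

variable {P : Type*} [PartialOrder P] {n : ℕ} {ω : P ≃ Fin n}

theorem mem_jordanHolderSet {π : Equiv.Perm (Fin n)} : π ∈ jordanHolderSet ω ↔
    ∀ i j : Fin n, ω.symm (π i) < ω.symm (π j) → i < j := by
  simp [jordanHolderSet]

/-- The poset ideal formed by the first `j` entries of the linear extension `π`. -/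
def prefixIdeal (π : jordanHolderSet ω) (j : ℕ) : LowerSet P where
  carrier := {p | ((π.1.symm (ω p) : Fin n) : ℕ) < j}
  lower' := by
    intro p q hqp hp
    rcases hqp.eq_or_lt with rfl | hlt
    · exact hp
    · have h := mem_jordanHolderSet.1 π.2 (π.1.symm (ω q)) (π.1.symm (ω p)) (by simpa using hlt)
      exact (Fin.lt_def.1 h).trans hp

theorem mem_prefixIdeal (π : jordanHolderSet ω) (j : ℕ) (p : P) :
    p ∈ prefixIdeal π j ↔ ((π.1.symm (ω p) : Fin n) : ℕ) < j := Iff.rfl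

/-- The exponent vector of the product of the variables of the prefix ideals of `π`, with
multiplicities `e`. -/
def prefixExponent (π : jordanHolderSet ω) (e : Fin (n + 1) → ℕ) : LowerSet P →₀ ℕ :=
  ∑ j : Fin (n + 1), Finsupp.single (prefixIdeal π j) (e j)

theorem weight_prefixExponent {M : Type*} [AddCommMonoid M] (w : LowerSet P → M)
    (π : jordanHolderSet ω) (e : Fin (n + 1) → ℕ) :
    Finsupp.weight w (prefixExponent π e) = ∑ j : Fin (n + 1), e j • w (prefixIdeal π j) := by
  simp [prefixExponent, Finsupp.weight_single]

theorem weight_toricExponent_none [Finite P] (π : jordanHolderSet ω) (e : Fin (n + 1) → ℕ) :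
    Finsupp.weight toricExponent (prefixExponent π e) none = ∑ j, e j := by
  simp [weight_prefixExponent, Finsupp.finsetSum_apply, toricExponent]

/-- Along π the toric exponents are tail sums of `e`: they weakly decrease, and their successive
differences recover `e`. -/
theorem weight_toricExponent_some [Finite P] (π : jordanHolderSet ω) (e : Fin (n + 1) → ℕ)
    (i : Fin n) :
    Finsupp.weight toricExponent (prefixExponent π e) (some (ω.symm (π.1 i))) =
      ∑ j with i.castSucc < j, e j := by
  simp [weight_prefixExponent, Finsupp.finsetSum_apply, toricExponent, mem_prefixIdeal,
    Finset.sum_filter, Fin.lt_def]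

/-- `Tuple.sort` breaks ties by index, and `OrderDual` makes it decreasing. A tie between two
entries forces `e` to vanish between them; then `he` excludes descents there, so the labels
increase. -/
theorem eq_sort_weight_toricExponent [Finite P] (π : jordanHolderSet ω) (e : Fin (n + 1) → ℕ)
    (he : ∀ j : Fin (n + 1), IsDescent π.1 j → e j ≠ 0) :
    π.1 = Tuple.sort fun x : Fin n =>
      OrderDual.toDual (Finsupp.weight toricExponent (prefixExponent π e) (some (ω.symm x))) := by
  rw [Tuple.eq_sort_iff]
  have hsub : ∀ i j : Fin n, i ≤ j →
      (Finset.univ.filter fun m : Fin (n + 1) => j.castSucc < m) ⊆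
        Finset.univ.filter fun m : Fin (n + 1) => i.castSucc < m := fun i j hij m hm => by
    simp only [Finset.mem_filter, Finset.mem_univ, true_and, Fin.lt_def, Fin.le_def,
      Fin.val_castSucc] at *
    omega
  constructor
  · intro i j hij
    simp only [Function.comp_apply, OrderDual.toDual_le_toDual, weight_toricExponent_some]
    exact Finset.sum_le_sum_of_subset (hsub i j hij)
  · intro i j hij heq
    simp only [EmbeddingLike.apply_eq_iff_eq, weight_toricExponent_some] at heq
    refine apply_lt_apply_of_forall_not_isDescent _ hij fun m h1 h2 hm => ?_
    have hmn : m < n + 1 := by omega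
    refine he ⟨m, hmn⟩ hm ?_
    by_contra h0
    refine (Finset.sum_lt_sum_of_subset (hsub i j hij.le) (i := ⟨m, hmn⟩) (f := e) ?_ ?_
      (Nat.pos_of_ne_zero h0) fun _ _ _ => Nat.zero_le _).ne' heq
    · simpa [Fin.lt_def] using h1
    · simpa [Fin.lt_def] using h2

theorem prefixExponent_weight_injective [Finite P] {π π' : jordanHolderSet ω}
    {e e' : Fin (n + 1) → ℕ} (he : ∀ j : Fin (n + 1), IsDescent π.1 j → e j ≠ 0)
    (he' : ∀ j : Fin (n + 1), IsDescent π'.1 j → e' j ≠ 0)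
    (h : Finsupp.weight toricExponent (prefixExponent π e) =
      Finsupp.weight toricExponent (prefixExponent π' e')) : π = π' ∧ e = e' := by
  obtain rfl : π = π' := Subtype.ext <| by
    rw [eq_sort_weight_toricExponent π e he, eq_sort_weight_toricExponent π' e' he', h]
  refine ⟨rfl, ?_⟩
  have tails : ∀ i : Fin (n + 1), ∑ j with i ≤ j, e j = ∑ j with i ≤ j, e' j := by
    intro i
    induction i using Fin.cases with
    -- The exponent of `s` is the total of `e`; this is the only tail sum that sees `e 0`.
    | zero =>
      simpa [weight_toricExponent_none] using DFunLike.congr_fun h none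
    | succ i =>
      have := DFunLike.congr_fun h (some (ω.symm (π.1 i)))
      rw [weight_toricExponent_some, weight_toricExponent_some] at this
      simpa only [Fin.castSucc_lt_iff_succ_le] using this
  have tails' : ∀ i : Fin (n + 1), ∑ j with i < j, e j = ∑ j with i < j, e' j := by
    intro i
    induction i using Fin.lastCases with
    | last => simp [Fin.lt_def, Finset.filter_eq_empty_iff.2
        fun (x : Fin (n + 1)) _ => not_lt.2 (Nat.lt_succ_iff.1 x.2)]
    | cast i => simpa only [Fin.castSucc_lt_iff_succ_le] using tails i.succ
  funext i
  have split : ∀ f : Fin (n + 1) → ℕ, ∑ j with i ≤ j, f j = f i + ∑ j with i < j, f j := by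
    intro f
    rw [← Finset.sum_insert (by simp)]
    congr 1
    ext j
    simp [le_iff_eq_or_lt, eq_comm]
  have h1 := tails i
  rw [split, split, tails' i] at h1
  omega

theorem prefixIdeal_injective (π : jordanHolderSet ω) :
    Function.Injective fun j : Fin (n + 1) => prefixIdeal π j := by
  have key : ∀ i j : Fin (n + 1), i < j → prefixIdeal π i ≠ prefixIdeal π j := by
    intro i j hij heq
    have hi : (i : ℕ) < n := by have := Fin.lt_def.1 hij; omega
    have : ω.symm (π.1 ⟨i, hi⟩) ∈ prefixIdeal π j := by
      simpa [mem_prefixIdeal] using hij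
    rw [← heq] at this
    simp [mem_prefixIdeal] at this
  intro i j h
  by_contra hne
  rcases lt_or_gt_of_ne hne with hlt | hlt
  · exact key i j hlt h
  · exact key j i hlt h.symm

theorem prefixExponent_apply_prefixIdeal (π : jordanHolderSet ω) (e : Fin (n + 1) → ℕ)
    (j : Fin (n + 1)) : prefixExponent π e (prefixIdeal π j) = e j := by
  classical
  simp only [prefixExponent, Finsupp.finsetSum_apply, Finsupp.single_apply]
  rw [Finset.sum_eq_single j]
  · simp
  · intro b _ hb
    exact if_neg fun h => hb (prefixIdeal_injective π h)
  · simp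

theorem weight_toricExponent_apply_some [Finite P] (m : LowerSet P →₀ ℕ) (p : P) :
    Finsupp.weight toricExponent m (some p) =
      ∑ α ∈ m.support, by classical exact if p ∈ α then m α else 0 := by
  classical
  simp [Finsupp.weight_apply, Finsupp.sum, Finsupp.finsetSum_apply, toricExponent]

theorem weight_toricExponent_mono [Finite P] (m : LowerSet P →₀ ℕ) {p q : P}
    (h : ∀ α ∈ m.support, q ∈ α → p ∈ α) :
    Finsupp.weight toricExponent m (some q) ≤ Finsupp.weight toricExponent m (some p) := by
  rw [weight_toricExponent_apply_some, weight_toricExponent_apply_some]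
  refine Finset.sum_le_sum fun α hα => ?_
  have := h α hα
  split_ifs <;> simp_all

theorem weight_toricExponent_lt [Finite P] {m : LowerSet P →₀ ℕ}
    (hm : IsChain (· ≤ ·) (m.support : Set (LowerSet P))) {α : LowerSet P} (hα : α ∈ m.support)
    {p q : P} (hp : p ∈ α) (hq : q ∉ α) :
    Finsupp.weight toricExponent m (some q) < Finsupp.weight toricExponent m (some p) := by
  rw [weight_toricExponent_apply_some, weight_toricExponent_apply_some]
  refine Finset.sum_lt_sum (fun β hβ => ?_) ⟨α, hα, ?_⟩
  · have : q ∈ β → p ∈ β := fun h => by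
      rcases hm.total hα hβ with h' | h'
      · exact h' hp
      · exact absurd (h' h) hq
    split_ifs <;> simp_all
  · simpa [hp, hq, Nat.pos_iff_ne_zero] using hα

/-- The sorting permutation of the toric exponents of `m` is the required linear extension, since
every ideal in the support of `m` is one of its prefixes. -/
theorem exists_prefixExponent_eq [Finite P] (hω : ∀ p q : P, p < q → ω p < ω q)
    {m : LowerSet P →₀ ℕ} (hm : IsChain (· ≤ ·) (m.support : Set (LowerSet P))) :
    ∃ (π : jordanHolderSet ω) (e : Fin (n + 1) → ℕ),
      (∀ j : Fin (n + 1), IsDescent π.1 j → e j ≠ 0) ∧ prefixExponent π e = m := by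
  classical
  set F : P → ℕ := fun p => Finsupp.weight toricExponent m (some p) with hF
  obtain ⟨σ, hσ⟩ : ∃ σ, σ = Tuple.sort fun x : Fin n => OrderDual.toDual (F (ω.symm x)) := ⟨_, rfl⟩
  rw [Tuple.eq_sort_iff] at hσ
  obtain ⟨hmono, htie⟩ := hσ
  have hanti : ∀ i j : Fin n, i ≤ j → F (ω.symm (σ j)) ≤ F (ω.symm (σ i)) :=
    fun i j hij => hmono hij
  have hmem : σ ∈ jordanHolderSet ω := by
    rw [mem_jordanHolderSet]
    intro i j hlt
    by_contra! hji
    have hne : j ≠ i := by rintro rfl; exact lt_irrefl _ hlt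
    have h1 : F (ω.symm (σ j)) ≤ F (ω.symm (σ i)) :=
      weight_toricExponent_mono m fun α _ h => α.lower hlt.le h
    -- An inversion of the order of `P` would force a tie, which the sort resolves by label; `hω`
    -- contradicts this.
    have h2 := htie j i (lt_of_le_of_ne hji hne)
      (congrArg OrderDual.toDual (le_antisymm h1 (hanti j i hji)))
    have h3 := hω _ _ hlt
    simp only [Equiv.apply_symm_apply] at h3
    exact lt_asymm h2 h3
  let π : jordanHolderSet ω := ⟨σ, hmem⟩
  have hprefix : ∀ α ∈ m.support, ∃ j : Fin (n + 1), prefixIdeal π j = α := by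
    intro α hα
    have hlt : ∀ i j : Fin n, ω.symm (σ i) ∈ α → j ≤ i → ω.symm (σ j) ∈ α := by
      intro i j hi hji
      by_contra hj
      exact absurd (weight_toricExponent_lt hm hα hi hj) (not_lt.2 (hanti j i hji))
    -- The prefix length is the first position whose entry lies outside `α`, or `n` if there is
    -- none.
    have hex : ∃ j : ℕ, ∀ h : j < n, ω.symm (σ ⟨j, h⟩) ∉ α := ⟨n, fun h => absurd h (lt_irrefl _)⟩
    have hle : Nat.find hex ≤ n := Nat.find_min' hex fun h => absurd h (lt_irrefl _)
    refine ⟨⟨Nat.find hex, Nat.lt_succ_of_le hle⟩, ?_⟩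
    ext p
    obtain ⟨i, rfl⟩ : ∃ i, p = ω.symm (σ i) := ⟨σ.symm (ω p), by simp⟩
    change ω.symm (σ i) ∈ prefixIdeal π _ ↔ ω.symm (σ i) ∈ α
    simp only [mem_prefixIdeal, Equiv.apply_symm_apply, π, Equiv.symm_apply_apply]
    constructor
    · intro h
      have := Nat.find_min hex h
      push Not at this
      exact this.2
    · intro h
      by_contra! h'
      have hn : Nat.find hex < n := h'.trans_lt i.2
      exact Nat.find_spec hex hn (hlt i ⟨_, hn⟩ h h')
  have hexp : prefixExponent π (fun j => m (prefixIdeal π j)) = m := by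
    ext α
    by_cases h : ∃ j : Fin (n + 1), prefixIdeal π j = α
    · obtain ⟨j, rfl⟩ := h
      rw [prefixExponent_apply_prefixIdeal]
    · have h0 : m α = 0 := by
        by_contra h0
        exact h (hprefix α (Finsupp.mem_support_iff.2 h0))
      push Not at h
      simp [prefixExponent, Finsupp.finsetSum_apply, h, h0]
  refine ⟨π, fun j => m (prefixIdeal π j), ?_, hexp⟩
  -- If the prefix ending at a descent had multiplicity 0, no ideal in the support would separate
  -- the two adjacent entries; their exponents would tie and the sort would put the smaller label
  -- first.
  rintro j ⟨i, hij, hin, hdesc⟩ h0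
  refine lt_asymm hdesc (htie i ⟨i + 1, hin⟩ (by simp [Fin.lt_def])
    (congrArg OrderDual.toDual ?_))
  refine le_antisymm (weight_toricExponent_mono m fun α hα h => ?_)
    (hanti i ⟨i + 1, hin⟩ (by simp [Fin.le_def]))
  obtain ⟨a, rfl⟩ := hprefix α hα
  have ha : a ≠ j := by rintro rfl; exact Finsupp.mem_support_iff.1 hα h0
  simp only [mem_prefixIdeal, Equiv.apply_symm_apply, π, Equiv.symm_apply_apply] at h ⊢
  have : (a : ℕ) ≠ j := fun h => ha (Fin.ext h)
  omega

end

/-! ### The Hilbert function counts standard monomials. -/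

theorem hilbertFunction_hibiIdeal {k : Type*} [Field k] {P : Type*} [PartialOrder P] [Finite P]
    {n : ℕ} {ω : P ≃ Fin n} (hω : ∀ p q : P, p < q → ω p < ω q) {ι : Type*}
    (w : LowerSet P → ι →₀ ℕ) (hw : ∀ α β, w (α ⊓ β) + w (α ⊔ β) = w α + w β) (a : ι →₀ ℕ) :
    hilbertFunction w (hibiIdeal k P) a =
      Nat.card {x : jordanHolderSet ω × (Fin (n + 1) → ℕ) //
        (∀ j : Fin (n + 1), IsDescent x.1.1 j → x.2 j ≠ 0) ∧
          Finsupp.weight w (prefixExponent x.1 x.2) = a} := by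
  let B := {x : jordanHolderSet ω × (Fin (n + 1) → ℕ) //
    (∀ j : Fin (n + 1), IsDescent x.1.1 j → x.2 j ≠ 0) ∧
      Finsupp.weight w (prefixExponent x.1 x.2) = a}
  let b : B → MvPolynomial (LowerSet P) k ⧸ hibiIdeal k P := fun x =>
    Ideal.Quotient.mkₐ k (hibiIdeal k P) (monomial (prefixExponent x.1.1 x.1.2) 1)
  have hspan : quotientComponent w (hibiIdeal k P) a = Submodule.span k (Set.range b) := by
    apply le_antisymm
    · rw [quotientComponent, Submodule.map_le_iff_le_comap]
      intro f hf
      rw [Submodule.mem_comap, f.as_sum, map_sum]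
      refine Submodule.sum_mem _ fun m hm => ?_
      rw [← mul_one (coeff m f), ← smul_eq_mul, ← smul_monomial, map_smul]
      refine Submodule.smul_mem _ _ ?_
      obtain ⟨m', hchain, hweight, hmem⟩ := exists_isChain_monomial_sub_mem (k := k)
        (fun α : LowerSet P => (α : Set P).ncard * (Nat.card P - (α : Set P).ncard))
        (fun _ _ => concave_rank_lt) w hw m
      obtain ⟨π, e, he, rfl⟩ := exists_prefixExponent_eq hω hchain
      refine Submodule.subset_span ⟨⟨⟨π, e⟩, he, ?_⟩, ?_⟩
      · rw [hweight]
        exact ((mem_weightedHomogeneousSubmodule k w a f).1 hf) (mem_support_iff.1 hm)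
      · exact (Ideal.Quotient.eq.2 hmem).symm
    · rw [Submodule.span_le]
      rintro _ ⟨x, rfl⟩
      exact Submodule.mem_map_of_mem
        ((mem_weightedHomogeneousSubmodule k w a _).2
          (isWeightedHomogeneous_monomial w _ _ x.2.2))
  have hli : LinearIndependent k b := by
    let φ : (MvPolynomial (LowerSet P) k ⧸ hibiIdeal k P) →ₐ[k] MvPolynomial (Option P) k :=
      Ideal.Quotient.liftₐ (hibiIdeal k P) (toricHom k P) fun f hf => toricHom_eq_zero k hf
    refine LinearIndependent.of_comp φ.toLinearMap ?_
    -- Distinct pairs map to distinct toric monomials, so independence is inherited from the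
    -- monomial basis.
    have hinj : Function.Injective fun x : B =>
        Finsupp.weight toricExponent (prefixExponent x.1.1 x.1.2) := by
      rintro ⟨⟨π, e⟩, h⟩ ⟨⟨π', e'⟩, h'⟩ hx
      obtain ⟨h1, h2⟩ := prefixExponent_weight_injective h.1 h'.1 hx
      exact Subtype.ext (Prod.ext h1 h2)
    have hb : φ.toLinearMap ∘ b = basisMonomials (Option P) k ∘ fun x : B =>
        Finsupp.weight toricExponent (prefixExponent x.1.1 x.1.2) := by
      funext x
      rw [Function.comp_apply, Function.comp_apply, coe_basisMonomials]
      exact toricHom_monomial k _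
    rw [hb]
    exact (basisMonomials (Option P) k).linearIndependent.comp _ hinj
  rw [hilbertFunction, hspan]
  exact Module.finrank_eq_nat_card_basis (Module.Basis.span hli)

/-! ### Coefficients of products of geometric series. -/

-- This is `X^d / (1 - X) = ∑_{t ≥ d} X^t`, checked by multiplying through by `1 - X`.
open Classical in
theorem coeff_X_pow_mul_inv_one_sub_X {σ K : Type*} [Field K] (i : σ) (d : ℕ) (b : σ →₀ ℕ) :
    MvPowerSeries.coeff b
        ((MvPowerSeries.X i : MvPowerSeries σ K) ^ d * (1 - MvPowerSeries.X i)⁻¹) =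
      if b = Finsupp.single i (b i) ∧ d ≤ b i then 1 else 0 := by
  let G : MvPowerSeries σ K := fun b => if b = Finsupp.single i (b i) ∧ d ≤ b i then 1 else 0
  suffices h : G = (MvPowerSeries.X i : MvPowerSeries σ K) ^ d * (1 - MvPowerSeries.X i)⁻¹ by
    rw [← h]; rfl
  rw [MvPowerSeries.eq_mul_inv_iff_mul_eq (by simp)]
  ext b
  have hG : ∀ b, MvPowerSeries.coeff b G = if b = Finsupp.single i (b i) ∧ d ≤ b i then 1 else 0 :=
    fun b => rfl
  rw [mul_sub, mul_one, map_sub, MvPowerSeries.coeff_X_pow, MvPowerSeries.X,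
    MvPowerSeries.coeff_mul_monomial, hG, hG]
  by_cases hb : b = Finsupp.single i (b i)
  · generalize b i = t at hb
    subst hb
    by_cases ht : t = 0
    · subst ht
      simp [eq_comm]
    · have h1 : Finsupp.single i 1 ≤ Finsupp.single i t := by
        simpa using Nat.one_le_iff_ne_zero.2 ht
      have h2 : Finsupp.single i t = Finsupp.single i d ↔ t = d :=
        (Finsupp.single_injective i).eq_iff
      simp only [h1, if_true, ← Finsupp.single_tsub, Finsupp.single_eq_same, true_and, h2]
      split_ifs <;> first | omega | simp
  · have h1 : b ≠ Finsupp.single i d := by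
      rintro rfl; simp at hb
    have h2 : Finsupp.single i 1 ≤ b →
        ¬ b - Finsupp.single i 1 = Finsupp.single i ((b - Finsupp.single i 1 : σ →₀ ℕ) i) := by
      intro hle h
      apply hb
      rw [← tsub_add_cancel_of_le hle, h]
      simp
    simp only [hb, h1, false_and, if_false, zero_sub, mul_one]
    split_ifs with h3 h4
    · exact absurd h4.1 (h2 h3)
    all_goals simp

theorem coeff_prod_X_pow_mul_inv_one_sub_X {σ K κ : Type*} [Field K] [Fintype κ] (s : κ → σ)
    (d : κ → ℕ) (a : σ →₀ ℕ) :
    MvPowerSeries.coeff a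
        (∏ j, (MvPowerSeries.X (s j) : MvPowerSeries σ K) ^ d j *
          (1 - MvPowerSeries.X (s j) : MvPowerSeries σ K)⁻¹) =
      Nat.card {e : κ → ℕ // d ≤ e ∧ ∑ j, Finsupp.single (s j) (e j) = a} := by
  classical
  rw [MvPowerSeries.coeff_prod]
  simp_rw [coeff_X_pow_mul_inv_one_sub_X]
  simp only [Finset.prod_boole, Finset.mem_univ, true_imp_iff]
  rw [Finset.sum_boole, ← Nat.card_eq_finsetCard]
  congr 1
  symm
  refine Nat.card_eq_of_bijective (fun e => ⟨Finsupp.equivFunOnFinite.symm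
    fun j => Finsupp.single (s j) (e.1 j), ?_⟩) ⟨?_, ?_⟩
  · rw [Finset.mem_filter, Finset.mem_finsuppAntidiag]
    refine ⟨⟨by simpa using e.2.2, Finset.subset_univ _⟩, fun j => ?_⟩
    simpa using e.2.1 j
  · rintro ⟨e, he⟩ ⟨e', he'⟩ h
    refine Subtype.ext (funext fun j => ?_)
    exact Finsupp.single_injective (s j) (DFunLike.congr_fun (congrArg Subtype.val h) j)
  · rintro ⟨l, hl⟩
    rw [Finset.mem_filter, Finset.mem_finsuppAntidiag] at hl
    refine ⟨⟨fun j => l j (s j), fun j => (hl.2 j).2, ?_⟩, ?_⟩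
    · rw [← hl.1.1]
      exact Finset.sum_congr rfl fun j _ => (hl.2 j).1.symm
    · refine Subtype.ext (Finsupp.ext fun j => ?_)
      exact (hl.2 j).1.symm

/-- Needed to add cardinalities over π, as `Nat.card` is 0 on infinite types. -/
theorem finite_sum_single_eq {σ κ : Type*} [Fintype κ] (s : κ → σ) (d : κ → ℕ) (a : σ →₀ ℕ) :
    Finite {e : κ → ℕ // d ≤ e ∧ ∑ j, Finsupp.single (s j) (e j) = a} := by
  classical
  refine ((Set.finite_Iic fun j => a (s j)).subset ?_).to_subtype
  rintro e ⟨-, rfl⟩ j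
  change e j ≤ (∑ i, Finsupp.single (s i) (e i)) (s j)
  rw [Finsupp.finsetSum_apply]
  simpa using Finset.single_le_sum (f := fun i => Finsupp.single (s i) (e i) (s j))
    (fun i _ => Nat.zero_le _) (Finset.mem_univ j)

/-! ### Grouping prefixes by their number of chain elements. -/

/-- The two descent sets are nested, so the truncated subtraction is a true difference. An index `j`
of `Fin n` becomes the position `j + 1`; position 0 is never a descent. -/
theorem descentsFrom_sub {n : ℕ} (π : Equiv.Perm (Fin n)) {x y : ℕ} (hxy : x ≤ y) :
    descentsFrom π x - descentsFrom π y =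
      Nat.card {j : Fin (n + 1) // (x ≤ j ∧ (j : ℕ) < y) ∧ IsDescent π j} := by
  classical
  rw [descentsFrom, descentsFrom, ← Finset.card_sdiff_of_subset]
  · rw [← Nat.card_eq_finsetCard]
    refine Nat.card_eq_of_bijective (fun j => ⟨j.1.succ, ?_⟩) ⟨?_, ?_⟩
    · have h := j.2
      simp only [Finset.mem_sdiff, Finset.mem_filter, Finset.mem_univ, true_and, not_and] at h
      refine ⟨⟨h.1.1, ?_⟩, j.1, rfl, h.1.2⟩
      by_contra! hy
      exact h.2 hy h.1.2
    · intro i j h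
      exact Subtype.ext (Fin.succ_injective _ (congrArg Subtype.val h))
    · rintro ⟨m, hm, j, hjm, hj⟩
      refine ⟨⟨j, ?_⟩, Subtype.ext (Fin.ext hjm)⟩
      rw [← hjm] at hm
      simp only [Finset.mem_sdiff, Finset.mem_filter, Finset.mem_univ, true_and, not_and]
      exact ⟨⟨hm.1, hj⟩, fun h => absurd h (not_le.2 hm.2)⟩
  · intro j hj
    simp only [Finset.mem_filter, Finset.mem_univ, true_and] at hj ⊢
    exact ⟨hxy.trans hj.1, hj.2⟩

theorem card_fin_between {N x y : ℕ} (hy : y ≤ N) :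
    Nat.card {j : Fin N // x ≤ j ∧ (j : ℕ) < y} = y - x := by
  rw [← Nat.card_Ico, ← Nat.card_eq_finsetCard]
  refine Nat.card_congr
    { toFun := fun j => ⟨j.1, Finset.mem_Ico.2 j.2⟩
      invFun := fun j => ⟨⟨j.1, (Finset.mem_Ico.1 j.2).2.trans_le hy⟩, Finset.mem_Ico.1 j.2⟩
      left_inv := fun _ => rfl
      right_inv := fun _ => rfl }

theorem prod_comp_pow_mul {M κ ι : Type*} [CommMonoid M] [Fintype κ] [Fintype ι] (s : κ → ι)
    (D : κ → Prop) [DecidablePred D] (u v : ι → M) :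
    ∏ j, u (s j) ^ (if D j then 1 else 0) * v (s j) =
      ∏ i, u i ^ Nat.card {j // s j = i ∧ D j} * v i ^ Nat.card {j // s j = i} := by
  classical
  rw [← Finset.prod_fiberwise Finset.univ s]
  refine Finset.prod_congr rfl fun i _ => ?_
  have hi : ∀ j ∈ Finset.univ.filter fun j => s j = i,
      u (s j) ^ (if D j then 1 else 0) * v (s j) = u i ^ (if D j then 1 else 0) * v i :=
    fun j hj => by rw [(Finset.mem_filter.1 hj).2]
  rw [Finset.prod_congr rfl hi]
  rw [Finset.prod_mul_distrib, Finset.prod_pow_eq_pow_sum, Finset.prod_const,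
    Nat.subtype_card (Finset.univ.filter fun j => s j = i ∧ D j) (by simp),
    Nat.subtype_card (Finset.univ.filter fun j => s j = i) (by simp),
    Finset.sum_boole, Finset.filter_filter, Nat.cast_id]

theorem chainIndex_le {P : Type*} {n ℓ : ℕ} {ω : P ≃ Fin n} (c : Fin ℓ → P)
    (π : Equiv.Perm (Fin n)) (i : ℕ) : chainIndex ω c π i ≤ n + 1 := by
  cases i with
  | zero => simp [chainIndex]
  | succ i => rw [chainIndex]; split_ifs <;> omega

variable {P : Type*} [PartialOrder P] {n ℓ : ℕ} {ω : P ≃ Fin n}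

open Classical in
/-- The number of elements of the chain `c` among the first `j` entries of `π`. -/
def chainCount (c : Fin ℓ → P) (π : jordanHolderSet ω) (j : ℕ) : Fin (ℓ + 1) :=
  ⟨(Finset.univ.filter fun i : Fin ℓ => c i ∈ prefixIdeal π j).card,
    Nat.lt_succ_of_le ((Finset.card_filter_le _ _).trans_eq (Finset.card_fin ℓ))⟩

theorem chainDegree_prefixIdeal (c : Fin ℓ → P) (π : jordanHolderSet ω) (j : ℕ) :
    chainDegree c (prefixIdeal π j) = Finsupp.single (chainCount c π j) 1 := rfl

/-- The chain elements in a prefix form an initial segment of the chain, so there are at least `i`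
of them exactly when the `i`-th is present. For `i = ℓ + 1` both sides fail. -/
theorem chainIndex_le_iff {c : Fin ℓ → P} (hc : StrictMono c) (π : jordanHolderSet ω)
    (j : Fin (n + 1)) {i : ℕ} (hi : i ≤ ℓ + 1) :
    chainIndex ω c π.1 i ≤ j ↔ i ≤ chainCount c π j := by
  classical
  cases i with
  | zero => simp [chainIndex]
  | succ i =>
    rw [chainIndex]
    split_ifs with h
    · rw [Nat.succ_le_iff, Nat.succ_le_iff]
      exact (Fin.lt_card_filter_univ_iff_apply_of_imp (j := ⟨i, h⟩)
        (fun i => c i ∈ prefixIdeal π j)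
        fun _ _ hab hb => (prefixIdeal π j).lower (hc.monotone hab) hb).symm
    · have h1 := j.2
      have h2 := (chainCount c π j).2
      omega

theorem chainIndex_le_succ {c : Fin ℓ → P} (hc : StrictMono c) (π : jordanHolderSet ω)
    {i : ℕ} (hi : i ≤ ℓ) : chainIndex ω c π.1 i ≤ chainIndex ω c π.1 (i + 1) := by
  rcases (chainIndex_le c π.1 (i + 1)).lt_or_eq with h | h
  · have h1 := (chainIndex_le_iff hc π ⟨_, h⟩ (i := i + 1) (by omega)).1 le_rfl
    exact (chainIndex_le_iff hc π ⟨_, h⟩ (by omega)).2 (by omega)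
  · rw [h]; exact chainIndex_le c π.1 i

theorem chainCount_eq_iff {c : Fin ℓ → P} (hc : StrictMono c) (π : jordanHolderSet ω)
    (j : Fin (n + 1)) (i : Fin (ℓ + 1)) :
    chainCount c π j = i ↔
      chainIndex ω c π.1 i ≤ j ∧ (j : ℕ) < chainIndex ω c π.1 (i + 1) := by
  rw [← not_le, chainIndex_le_iff hc π j (by omega), chainIndex_le_iff hc π j (by omega),
    Fin.ext_iff]
  omega

-- The prefix lengths `j` containing exactly `i` chain elements fill the interval from `ind(π, c_i)`
-- up to, but excluding, `ind(π, c_{i+1})`. Its length is the exponent of `v i`, its number of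
-- descents that of `u i`.
open Classical in
theorem prod_chainIndex_eq {M : Type*} [CommMonoid M] {c : Fin ℓ → P} (hc : StrictMono c)
    (π : jordanHolderSet ω) (u v : Fin (ℓ + 1) → M) :
    ∏ i : Fin (ℓ + 1),
        u i ^ (descentsFrom π.1 (chainIndex ω c π.1 i) -
            descentsFrom π.1 (chainIndex ω c π.1 (i + 1))) *
          v i ^ (chainIndex ω c π.1 (i + 1) - chainIndex ω c π.1 i) =
      ∏ j : Fin (n + 1), u (chainCount c π j) ^ (if IsDescent π.1 j then 1 else 0) *
        v (chainCount c π j) := by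
  rw [prod_comp_pow_mul (fun j : Fin (n + 1) => chainCount c π j) fun j => IsDescent π.1 j]
  refine Finset.prod_congr rfl fun i _ => ?_
  simp only [chainCount_eq_iff hc]
  rw [descentsFrom_sub _ (chainIndex_le_succ hc π (by omega)),
    card_fin_between (chainIndex_le c π.1 _)]

end MultigradedHibi

end
open MultigradedHibi in
/-- The multigraded Hilbert series of the Hibi ring of a naturally labelled finite poset. -/
theorem theorem3p2 {k : Type*} [Field k] {P : Type*} [PartialOrder P] {n : ℕ}
    (ω : P ≃ Fin n) (hω : ∀ p q : P, p < q → ω p < ω q)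
    {ℓ : ℕ} (c : Fin ℓ → P) (hc : StrictMono c) :
    hilbertSeries (chainDegree c) (hibiIdeal k P) =
      ∑ π ∈ jordanHolderSet ω, ∏ i : Fin (ℓ + 1),
        (MvPowerSeries.X i : MvPowerSeries (Fin (ℓ + 1)) ℚ) ^
            (descentsFrom π (chainIndex ω c π i) - descentsFrom π (chainIndex ω c π (i + 1))) *
          ((1 - MvPowerSeries.X i : MvPowerSeries (Fin (ℓ + 1)) ℚ)⁻¹) ^
            (chainIndex ω c π (i + 1) - chainIndex ω c π i) := by
  classical
  have : Finite P := Finite.of_equiv _ ω.symm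
  ext a
  have hlhs : MvPowerSeries.coeff a (hilbertSeries (chainDegree c) (hibiIdeal k P)) =
    (hilbertFunction (chainDegree c) (hibiIdeal k P) a : ℚ) := rfl
  rw [hlhs, hilbertFunction_hibiIdeal hω _ (chainDegree_inf_add_sup hc), ← Finset.sum_coe_sort,
    map_sum]
  -- As the indicator of descents, `d` turns the nonvanishing condition on `e` into `d π ≤ e`.
  let d (π : jordanHolderSet ω) (j : Fin (n + 1)) : ℕ := if IsDescent π.1 j then 1 else 0
  have hrhs : ∀ π : jordanHolderSet ω, MvPowerSeries.coeff a (∏ i : Fin (ℓ + 1),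
      (MvPowerSeries.X i : MvPowerSeries (Fin (ℓ + 1)) ℚ) ^
          (descentsFrom π.1 (chainIndex ω c π.1 i) -
            descentsFrom π.1 (chainIndex ω c π.1 (i + 1))) *
        ((1 - MvPowerSeries.X i : MvPowerSeries (Fin (ℓ + 1)) ℚ)⁻¹) ^
          (chainIndex ω c π.1 (i + 1) - chainIndex ω c π.1 i)) =
      Nat.card {e : Fin (n + 1) → ℕ //
        d π ≤ e ∧ ∑ j : Fin (n + 1), Finsupp.single (chainCount c π j) (e j) = a} := fun π => by
    rw [prod_chainIndex_eq hc π (fun i => (MvPowerSeries.X i : MvPowerSeries (Fin (ℓ + 1)) ℚ))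
      fun i => (1 - MvPowerSeries.X i : MvPowerSeries (Fin (ℓ + 1)) ℚ)⁻¹]
    exact coeff_prod_X_pow_mul_inv_one_sub_X _ (d π) a
  rw [Finset.sum_congr rfl fun π _ => hrhs π, ← Nat.cast_sum]
  have := fun π : jordanHolderSet ω =>
    finite_sum_single_eq (fun j : Fin (n + 1) => chainCount c π j) (d π) a
  rw [← Nat.card_sigma, Nat.cast_inj]
  have hiff : ∀ (π : jordanHolderSet ω) (e : Fin (n + 1) → ℕ),
      ((∀ j : Fin (n + 1), IsDescent π.1 j → e j ≠ 0) ∧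
        Finsupp.weight (chainDegree c) (prefixExponent π e) = a) ↔
      (d π ≤ e ∧ ∑ j : Fin (n + 1), Finsupp.single (chainCount c π j) (e j) = a) := by
    intro π e
    refine and_congr (forall_congr' fun j => ?_) ?_
    · by_cases h : IsDescent π.1 j <;> simp [d, h, Nat.one_le_iff_ne_zero]
    · simp [weight_prefixExponent, chainDegree_prefixIdeal]
  refine Nat.card_congr
    { toFun := fun x => ⟨x.1.1, x.1.2, (hiff _ _).1 x.2⟩
      invFun := fun x => ⟨⟨x.1, x.2.1⟩, (hiff _ _).2 x.2.2⟩
      left_inv := fun _ => rfl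
      right_inv := fun _ => rfl }
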